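/- Let $\ell_1(\omega_2)$ be the real Banach space of absolutely summable families indexed by the ordinal $\omega_2$. For a real Banach space $X$: - A \emph{projectional skeleton} in $X$ is a family $\mathfrak s=\{P_s\}_{s\in\Gamma}$ of bounded linear projections of $X$ (i.e. $P_s\circ P_s=P_s$), indexed by a directed partially ordered set $\Gamma$, with $\sup_{s\in\Gamma}\|P_s\|<\infty$, such that (1) $X=\bigcup_{s\in\Gamma}P_sX$ and each $P_sX$ is separable; (2) $s\le t$ implies $P_s=P_s\circ P_t=P_t\circ P_s$; (3) if $s_0<s_1<\cdots$ in $\Gamma$, then $t=\sup_n s_n$ exists in $\Gamma$ and $P_tX=\overline{\bigcup_n P_{s_n}X}$. It is a \emph{$1$-projectional skeleton} if $\|P_s\|\le 1$ for all $s\in\Gamma$. The linear subspace of $X^*$ \emph{induced} by $\mathfrak s$ is $D(\mathfrak s)=\bigcup_{s\in\Gamma}P_s^*X^*$. - A set $D\subseteq X^*$ is \emph{$r$-norming} if $\|x\|\le r\,\sup\{|\varphi(x)|/\|\varphi\| : \varphi\in D\setminus\{0\}\}$ for all $x\in X$, and \emph{norming} if it is $r$-norming for some $r$. - A norming linear subspace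 $D\subseteq X^*$ forms a \emph{Plichko pair} $(X,D)$ if there is a linearly dense set $A\subseteq X$ such that $\{a\in A: y(a)\neq 0\}$ is countable for every $y\in D$. It is a \emph{$\Sigma$-space} if there is a linearly dense set $A\subseteq X$ with $D=\{y\in X^* : \{a\in A: y(a)\ne 0\}\text{ is countable}\}$. Then there exists a $1$-projectional skeleton $\mathfrak s$ on $\ell_1(\omega_2)$ such that the induced subspace $D(\mathfrak s)$, which is $1$-norming, is not a $\Sigma$-space and $(\ell_1(\omega_2),D(\mathfrak s))$ is not a Plichko pair. -/

import Mathlib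

open scoped Ordinal

/-- A projectional skeleton in a (real) Banach space `X`, indexed by the partially ordered set `Γ`:
a family of bounded projections indexed by a directed poset, with separable ranges covering `X`,
compatible with the order, continuous along increasing sequences, and uniformly bounded. -/
structure ProjectionalSkeleton (X : Type*) [NormedAddCommGroup X] [NormedSpace ℝ X]
    (Γ : Type*) [PartialOrder Γ] where
  /-- The projections `P_s`. -/
  proj : Γ → X →L[ℝ] X
  proj_idem : ∀ s, (proj s).comp (proj s) = proj s
  directed : ∀ s t : Γ, ∃ u, s ≤ u ∧ t ≤ u
  cover : ⋃ s, Set.range (proj s) = Set.univ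
  separable : ∀ s, TopologicalSpace.IsSeparable (Set.range (proj s))
  compat : ∀ s t, s ≤ t →
    proj s = (proj s).comp (proj t) ∧ proj s = (proj t).comp (proj s)
  sigma_complete : ∀ s : ℕ → Γ, StrictMono s →
    ∃ t, IsLUB (Set.range s) t ∧
      Set.range (proj t) = closure (⋃ n, Set.range (proj (s n)))
  bounded : ∃ r : ℝ, ∀ s, ‖proj s‖ ≤ r

namespace ProjectionalSkeleton

variable {X : Type*} [NormedAddCommGroup X] [NormedSpace ℝ X] {Γ : Type*} [PartialOrder Γ]

/-- `𝔰` is an `r`-projectional skeleton: every projection has norm at most `r`. -/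
def IsRSkeleton (𝔰 : ProjectionalSkeleton X Γ) (r : ℝ) : Prop :=
  ∀ s, ‖𝔰.proj s‖ ≤ r

/-- The subspace `D(𝔰) = ⋃ₛ Pₛ* X*` of the dual induced by the skeleton `𝔰`, where
`Pₛ* φ = φ ∘ Pₛ`. -/
def inducedSpace (𝔰 : ProjectionalSkeleton X Γ) : Submodule ℝ (StrongDual ℝ X) where
  carrier := ⋃ s, Set.range fun φ : StrongDual ℝ X => φ.comp (𝔰.proj s)
  zero_mem' := by
    have h : (0 : X) ∈ ⋃ s, Set.range (𝔰.proj s) := by rw [𝔰.cover]; trivial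
    obtain ⟨s, -⟩ := Set.mem_iUnion.1 h
    exact Set.mem_iUnion.2 ⟨s, 0, by simp⟩
  add_mem' := by
    intro a b ha hb
    obtain ⟨s, φ, rfl⟩ := Set.mem_iUnion.1 ha
    obtain ⟨t, ψ, rfl⟩ := Set.mem_iUnion.1 hb
    obtain ⟨u, hsu, htu⟩ := 𝔰.directed s t
    refine Set.mem_iUnion.2 ⟨u, φ.comp (𝔰.proj s) + ψ.comp (𝔰.proj t), ?_⟩
    have h1 := (𝔰.compat s u hsu).1
    have h2 := (𝔰.compat t u htu).1
    simp only [ContinuousLinearMap.add_comp, ContinuousLinearMap.comp_assoc]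
    rw [← h1, ← h2]
  smul_mem' := by
    intro c a ha
    obtain ⟨s, φ, rfl⟩ := Set.mem_iUnion.1 ha
    exact Set.mem_iUnion.2 ⟨s, c • φ, by simp⟩

end ProjectionalSkeleton

/-- A set `D` of functionals is `r`-norming: `‖x‖ ≤ r |x|` for all `x`, where
`|x| = sup {|φ x| / ‖φ‖ : φ ∈ D, φ ≠ 0}` (the inequality `|x| ≤ ‖x‖` always holds). -/
def IsRNorming {X : Type*} [NormedAddCommGroup X] [NormedSpace ℝ X]
    (r : ℝ) (D : Set (StrongDual ℝ X)) : Prop :=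
  ∀ x : X, ‖x‖ ≤ r * sSup ((fun φ : StrongDual ℝ X => |φ x| / ‖φ‖) '' (D \ {0}))

/-- A set of functionals is norming if it is `r`-norming for some `r`. -/
def IsNorming {X : Type*} [NormedAddCommGroup X] [NormedSpace ℝ X]
    (D : Set (StrongDual ℝ X)) : Prop :=
  ∃ r : ℝ, IsRNorming r D

/-- The `A`-support of a functional `y`. -/
def functionalSupport {X : Type*} [NormedAddCommGroup X] [NormedSpace ℝ X]
    (y : StrongDual ℝ X) (A : Set X) : Set X :=
  {a ∈ A | y a ≠ 0}

/-- `(X, D)` is a Plichko pair: `D` is a norming linear subspace of the dual and there is a linearly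
dense set `A ⊆ X` such that every element of `D` has countable `A`-support. -/
def IsPlichkoPair (X : Type*) [NormedAddCommGroup X] [NormedSpace ℝ X]
    (D : Submodule ℝ (StrongDual ℝ X)) : Prop :=
  IsNorming (D : Set (StrongDual ℝ X)) ∧
    ∃ A : Set X, Dense (Submodule.span ℝ A : Set X) ∧
      ∀ y ∈ D, (functionalSupport y A).Countable

/-- `D` is a `Σ`-space: it is norming and it consists exactly of the functionals with
countable `A`-support, for some linearly dense set `A ⊆ X`. -/
def IsSigmaSpace {X : Type*} [NormedAddCommGroup X] [NormedSpace ℝ X]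
    (D : Submodule ℝ (StrongDual ℝ X)) : Prop :=
  IsNorming (D : Set (StrongDual ℝ X)) ∧
    ∃ A : Set X, Dense (Submodule.span ℝ A : Set X) ∧
      (D : Set (StrongDual ℝ X)) = {y | (functionalSupport y A).Countable}

/-- The real Banach space `ℓ₁(ω₂)`: the index set is the ordinal `ω₂`. -/
abbrev EllOneOmegaTwo : Type :=
  lp (fun _ : (ω_ 2 : Ordinal.{0}).ToType => ℝ) 1

theorem aleph_two_eq_succ : Cardinal.aleph 2 = Order.succ (Cardinal.aleph 1) := by
  rw [Cardinal.succ_aleph, one_add_one_eq_two]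

theorem mk_Iic_omega_two_le (a : (ω_ 2 : Ordinal.{0}).ToType) :
    Cardinal.mk (Set.Iic a) ≤ Cardinal.aleph 1 := by
  have hI : Cardinal.mk (ω_ 2 : Ordinal.{0}).ToType = Cardinal.aleph 2 := by simp
  have hlt : Cardinal.mk (Set.Iio a) < Cardinal.aleph 2 := by
    rw [← hI]
    exact Cardinal.mk_Iio_lt a (by simp)
  rw [← Order.lt_succ_iff, ← aleph_two_eq_succ, ← Set.Iio_insert]
  exact Cardinal.mk_insert_le.trans_lt (Cardinal.add_lt_of_lt (Cardinal.aleph0_le_aleph 2) hlt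
    (Cardinal.one_lt_aleph0.trans_le (Cardinal.aleph0_le_aleph 2)))

theorem exists_forall_lt_of_mk_le_aleph_one (S : Set (ω_ 2 : Ordinal.{0}).ToType)
    (hS : Cardinal.mk S ≤ Cardinal.aleph 1) : ∃ b, ∀ s ∈ S, s < b := by
  have hcof : Order.cof (ω_ 2 : Ordinal.{0}).ToType = Cardinal.aleph 2 := by
    rw [Ordinal.cof_toType, ← Cardinal.ord_aleph, aleph_two_eq_succ]
    exact (Cardinal.isRegular_succ (Cardinal.aleph0_le_aleph 1)).cof_ord
  have hS' : ¬ IsCofinal S := fun h => by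
    have := (Order.cof_le h).trans hS
    rw [hcof, aleph_two_eq_succ] at this
    exact this.not_gt (Order.lt_succ _)
  simpa [IsCofinal] using hS'

/-- The cuts of the linear order `I` that split none of the sets `supp x`, `x ∈ A`. -/
def unsplitCuts {I X : Type*} [LinearOrder I] (A : Set X) (supp : X → Set I) : Set I :=
  {c | ∀ x ∈ A, ∀ i ∈ supp x, i < c → ∀ j ∈ supp x, j < c}

section Cuts

variable {I X : Type} [LinearOrder I] [WellFoundedLT I] {A : Set X} {supp : X → Set I}

/-- If only few sets start below each point, then arbitrarily large cuts split none of them. -/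
theorem exists_lt_mem_unsplitCuts
    (hIic : ∀ a : I, Cardinal.mk (Set.Iic a) ≤ Cardinal.aleph 1)
    (hbdd : ∀ S : Set I, Cardinal.mk S ≤ Cardinal.aleph 1 → ∃ b, ∀ s ∈ S, s < b)
    (hsupp : ∀ x ∈ A, (supp x).Countable)
    (hleast : ∀ b, {x ∈ A | IsLeast (supp x) b}.Countable) (a : I) :
    ∃ c ∈ unsplitCuts A supp, a < c := by
  have hstep : ∀ a : I, ∃ b, a < b ∧ ∀ x ∈ A, ∀ i ∈ supp x, i ≤ a → ∀ j ∈ supp x, j < b := by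
    intro a
    have hcard : Cardinal.mk (⋃ b : Set.Iic a, ⋃ x : {x ∈ A | IsLeast (supp x) b.1}, supp x.1 :
        Set I) ≤ Cardinal.aleph 1 := by
      refine (Cardinal.mk_iUnion_le_sum_mk).trans ((Cardinal.sum_le_mk_mul_iSup _).trans ?_)
      refine (mul_le_mul' (hIic a) (ciSup_le' fun b => ?_)).trans_eq
        (Cardinal.mul_eq_self (Cardinal.aleph0_le_aleph 1))
      have : Countable {x ∈ A | IsLeast (supp x) b.1} := (hleast b).to_subtype
      refine le_trans (Set.Countable.le_aleph0 ?_) (Cardinal.aleph0_le_aleph 1)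
      exact Set.countable_iUnion fun x => hsupp _ x.2.1
    obtain ⟨b, hb⟩ := hbdd _ hcard
    obtain ⟨b', hb'⟩ := hbdd {a} ((Set.countable_singleton a).le_aleph0.trans
      (Cardinal.aleph0_le_aleph 1))
    refine ⟨max b b', lt_max_of_lt_right (hb' a rfl), fun x hx i hi hia j hj =>
      lt_max_of_lt_left (hb j ?_)⟩
    have hne : (supp x).Nonempty := ⟨i, hi⟩
    have hl : IsLeast (supp x) (wellFounded_lt.min (supp x) hne) :=
      ⟨wellFounded_lt.min_mem _ hne, fun k hk => wellFounded_lt.min_le hk⟩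
    exact Set.mem_iUnion.2 ⟨⟨_, (hl.2 hi).trans hia⟩, Set.mem_iUnion.2 ⟨⟨x, hx, hl⟩, hj⟩⟩
  choose h hlt hh using hstep
  have hne : {c | ∀ n : ℕ, h^[n] a < c}.Nonempty := by
    obtain ⟨b, hb⟩ := hbdd (Set.range fun n : ℕ => h^[n] a)
      ((Set.countable_range _).le_aleph0.trans (Cardinal.aleph0_le_aleph 1))
    exact ⟨b, fun n => hb _ ⟨n, rfl⟩⟩
  refine ⟨wellFounded_lt.min _ hne, ?_, wellFounded_lt.min_mem _ hne 0⟩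
  intro x hx i hi hic j hj
  have : ∃ n : ℕ, i ≤ h^[n] a := by
    by_contra! hcon
    exact wellFounded_lt.not_lt_min {c | ∀ n : ℕ, h^[n] a < c} hcon hic
  obtain ⟨n, hn⟩ := this
  refine (hh _ x hx i hi hn j hj).trans ?_
  rw [← Function.iterate_succ_apply' h]
  exact wellFounded_lt.min_mem _ hne (n + 1)

/-- Some cut that splits none of the sets is approached by such cuts with uncountable cofinality. -/
theorem exists_unsplit_limit
    (hIic : ∀ a : I, Cardinal.mk (Set.Iic a) ≤ Cardinal.aleph 1)
    (hbdd : ∀ S : Set I, Cardinal.mk S ≤ Cardinal.aleph 1 → ∃ b, ∀ s ∈ S, s < b)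
    (hsupp : ∀ x ∈ A, (supp x).Countable)
    (hleast : ∀ b, {x ∈ A | IsLeast (supp x) b}.Countable) :
    ∃ d ∈ unsplitCuts A supp, ∀ S ⊆ Set.Iio d, S.Countable →
      ∃ c ∈ unsplitCuts A supp, c < d ∧ ∀ s ∈ S, s < c := by
  set C := unsplitCuts A supp
  have hunb := exists_lt_mem_unsplitCuts hIic hbdd hsupp hleast
  have hlarge : ¬ Cardinal.mk C ≤ Cardinal.aleph 1 := fun h => by
    obtain ⟨b, hb⟩ := hbdd C h
    obtain ⟨c, hc, hbc⟩ := hunb b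
    exact (hb c hc).not_gt hbc
  obtain ⟨B, hBC, hB⟩ := Cardinal.le_mk_iff_exists_subset.1 (not_le.1 hlarge).le
  have hne : {d | ¬ (C ∩ Set.Iio d).Countable}.Nonempty := by
    obtain ⟨b, hb⟩ := hbdd B hB.le
    refine ⟨b, fun (h : (C ∩ Set.Iio b).Countable) => ?_⟩
    have hBc : B.Countable := h.mono (Set.subset_inter hBC hb)
    have := hBc.le_aleph0
    rw [hB] at this
    exact this.not_gt Cardinal.aleph0_lt_aleph_one
  set d := wellFounded_lt.min _ hne
  have hdunc : ¬ (C ∩ Set.Iio d).Countable := wellFounded_lt.min_mem _ hne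
  have hdmin : ∀ e < d, (C ∩ Set.Iio e).Countable := fun e he => by
    by_contra hcon
    exact wellFounded_lt.not_lt_min {d | ¬ (C ∩ Set.Iio d).Countable} hcon he
  have happrox : ∀ S ⊆ Set.Iio d, S.Countable → ∃ c ∈ C, c < d ∧ ∀ s ∈ S, s < c := by
    intro S hS hSc
    by_contra! hcon
    refine hdunc ((hSc.biUnion fun s hs => ((hdmin s (hS hs)).union
      (Set.countable_singleton s))).mono fun c hc => ?_)
    obtain ⟨s, hs, hcs⟩ := hcon c hc.1 hc.2
    refine Set.mem_iUnion₂.2 ⟨s, hs, ?_⟩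
    exact hcs.lt_or_eq.imp (fun h => ⟨hc.1, h⟩) fun h => h
  refine ⟨d, fun x hx i hi hid j hj => ?_, happrox⟩
  obtain ⟨c, hc, hcd, hic⟩ := happrox {i} (by simpa using hid) (Set.countable_singleton i)
  exact (hc x hx i hi (hic i rfl) j hj).trans hcd

end Cuts

section EllOne

variable {I E : Type*} [NormedAddCommGroup E] [NormedSpace ℝ E]

theorem lp.summable_abs_one (x : lp (fun _ : I => ℝ) 1) : Summable fun i => ‖x i‖ := by
  simpa using (lp.memℓp x).summable (by simp)

theorem lp.norm_eq_tsum_one (x : lp (fun _ : I => ℝ) 1) : ‖x‖ = ∑' i, ‖x i‖ := by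
  rw [lp.norm_eq_tsum_rpow (by simp)]
  simp

theorem lp.countable_support_one (x : lp (fun _ : I => ℝ) 1) : (Function.support x).Countable := by
  simpa [Function.support] using (lp.summable_abs_one x).countable_support

theorem lp.clm_ext_one [DecidableEq I] {f g : lp (fun _ : I => ℝ) 1 →L[ℝ] E}
    (h : ∀ i, f (lp.single 1 i 1) = g (lp.single 1 i 1)) : f = g := by
  refine lp.ext_continuousLinearMap ENNReal.one_ne_top fun i => ?_
  ext
  simpa using h i

variable [CompleteSpace E]

theorem lp.summable_smul_of_norm_le_one {v : I → E} (hv : ∀ i, ‖v i‖ ≤ 1)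
    (x : lp (fun _ : I => ℝ) 1) : Summable fun i => x i • v i :=
  .of_norm_bounded (lp.summable_abs_one x) fun i => by
    rw [norm_smul]; exact mul_le_of_le_one_right (norm_nonneg _) (hv i)

/-- The operator on `ℓ₁(I)` sending the unit vectors to the vectors `v i` of the unit ball. -/
noncomputable def lp.liftOne (v : I → E) (hv : ∀ i, ‖v i‖ ≤ 1) :
    lp (fun _ : I => ℝ) 1 →L[ℝ] E :=
  LinearMap.mkContinuous
    { toFun := fun x => ∑' i, x i • v i
      map_add' := fun x y => by
        rw [← (lp.summable_smul_of_norm_le_one hv x).tsum_add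
          (lp.summable_smul_of_norm_le_one hv y)]
        simp [add_smul]
      map_smul' := fun c x => by
        rw [RingHom.id_apply, ← (lp.summable_smul_of_norm_le_one hv x).tsum_const_smul]
        simp [mul_smul] }
    1 (fun x => by
      rw [one_mul, lp.norm_eq_tsum_one]
      refine tsum_of_norm_bounded (lp.summable_abs_one x).hasSum fun i => ?_
      rw [norm_smul]; exact mul_le_of_le_one_right (norm_nonneg _) (hv i))

theorem lp.liftOne_apply (v : I → E) (hv : ∀ i, ‖v i‖ ≤ 1) (x : lp (fun _ : I => ℝ) 1) :
    lp.liftOne v hv x = ∑' i, x i • v i := rfl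

theorem lp.norm_liftOne_le (v : I → E) (hv : ∀ i, ‖v i‖ ≤ 1) : ‖lp.liftOne v hv‖ ≤ 1 :=
  LinearMap.mkContinuous_norm_le _ zero_le_one _

theorem lp.liftOne_single [DecidableEq I] (v : I → E) (hv : ∀ i, ‖v i‖ ≤ 1) (i : I) :
    lp.liftOne v hv (lp.single 1 i 1) = v i := by
  rw [lp.liftOne_apply, tsum_eq_single i fun j hj => by simp [lp.single_apply, hj]]
  simp

end EllOne

section Cut

variable {I : Type*} [LinearOrder I] [WellFoundedLT I]

open Classical in
/-- The unit vector at the least element of `A` above `i`, or zero if there is none. -/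
noncomputable def cutVector (A : Set I) (i : I) : lp (fun _ : I => ℝ) 1 :=
  if h : (A ∩ Set.Ici i).Nonempty then lp.single 1 (wellFounded_lt.min _ h) (1 : ℝ) else 0

theorem cutVector_cases (A : Set I) (i : I) :
    (A ∩ Set.Ici i = ∅ ∧ cutVector A i = 0) ∨
      ∃ a, IsLeast (A ∩ Set.Ici i) a ∧ cutVector A i = lp.single 1 a (1 : ℝ) := by
  by_cases h : (A ∩ Set.Ici i).Nonempty
  · exact .inr ⟨wellFounded_lt.min _ h,
      ⟨wellFounded_lt.min_mem _ h, fun k hk => wellFounded_lt.min_le hk⟩, by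
        simp only [cutVector, dif_pos h]⟩
  · exact .inl ⟨Set.not_nonempty_iff_eq_empty.1 h, by simp only [cutVector, dif_neg h]⟩

theorem cutVector_of_isLeast {A : Set I} {i a : I} (h : IsLeast (A ∩ Set.Ici i) a) :
    cutVector A i = lp.single 1 a (1 : ℝ) := by
  obtain ⟨h0, -⟩ | ⟨b, hb, hb'⟩ := cutVector_cases A i
  · exact absurd h.1 (by simp [h0])
  · rw [hb', hb.unique h]

theorem cutVector_of_eq_empty {A : Set I} {i : I} (h : A ∩ Set.Ici i = ∅) : cutVector A i = 0 := by
  obtain ⟨-, h0⟩ | ⟨b, hb, -⟩ := cutVector_cases A i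
  · exact h0
  · exact absurd hb.1 (by simp [h])

theorem cutVector_of_mem {A : Set I} {i : I} (h : i ∈ A) :
    cutVector A i = lp.single 1 i (1 : ℝ) :=
  cutVector_of_isLeast ⟨⟨h, le_rfl⟩, fun _ hk => hk.2⟩

theorem norm_cutVector_le (A : Set I) (i : I) : ‖cutVector A i‖ ≤ 1 := by
  obtain ⟨-, h0⟩ | ⟨b, -, hb⟩ := cutVector_cases A i
  · simp [h0]
  · simp [hb]

/-- The projection of `ℓ₁(I)` onto `ℓ₁(A)` moving each coordinate up to the next element of `A`. -/
noncomputable def cutProj (A : Set I) : lp (fun _ : I => ℝ) 1 →L[ℝ] lp (fun _ : I => ℝ) 1 :=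
  lp.liftOne (cutVector A) (norm_cutVector_le A)

theorem cutProj_single (A : Set I) (i : I) : cutProj A (lp.single 1 i 1) = cutVector A i :=
  lp.liftOne_single _ _ i

theorem norm_cutProj_le (A : Set I) : ‖cutProj A‖ ≤ 1 := lp.norm_liftOne_le _ _

theorem cutProj_comp_of_subset {A B : Set I} (h : A ⊆ B) :
    (cutProj A).comp (cutProj B) = cutProj A := by
  refine lp.clm_ext_one fun i => ?_
  rw [ContinuousLinearMap.comp_apply, cutProj_single, cutProj_single]
  obtain ⟨h0, h0'⟩ | ⟨b, hb, hb'⟩ := cutVector_cases B i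
  · rw [h0', map_zero, cutVector_of_eq_empty]
    exact Set.subset_empty_iff.1 (h0 ▸ Set.inter_subset_inter_left _ h)
  · rw [hb', cutProj_single]
    have : A ∩ Set.Ici b = A ∩ Set.Ici i := by
      ext k
      exact ⟨fun hk => ⟨hk.1, hb.1.2.trans hk.2⟩, fun hk => ⟨hk.1, hb.2 ⟨h hk.1, hk.2⟩⟩⟩
    obtain ⟨h0, h0'⟩ | ⟨a, ha, ha'⟩ := cutVector_cases A i
    · rw [h0', cutVector_of_eq_empty (this.trans h0)]
    · rw [ha', cutVector_of_isLeast (this ▸ ha)]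

theorem cutProj_comp_of_superset {A B : Set I} (h : A ⊆ B) :
    (cutProj B).comp (cutProj A) = cutProj A := by
  refine lp.clm_ext_one fun i => ?_
  rw [ContinuousLinearMap.comp_apply, cutProj_single]
  obtain ⟨-, h0⟩ | ⟨b, hb, hb'⟩ := cutVector_cases A i
  · rw [h0, map_zero]
  · rw [hb', cutProj_single, cutVector_of_mem (h hb.1.1)]

theorem cutProj_eq_self {A : Set I} {x : lp (fun _ : I => ℝ) 1} (h : Function.support x ⊆ A) :
    cutProj A x = x := by
  have hx := lp.hasSum_single ENNReal.one_ne_top x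
  refine ((hx.map (cutProj A) (cutProj A).continuous).congr_fun ?_).unique hx
  intro i
  by_cases hi : x i = 0
  · simp [hi]
  · have hs : lp.single 1 i (x i) = x i • (lp.single 1 i 1 : lp (fun _ : I => ℝ) 1) := by
      rw [← lp.single_smul]; simp
    simp only [Function.comp_apply]
    rw [hs, map_smul, cutProj_single, cutVector_of_mem (h hi)]

theorem range_cutProj_subset (A : Set I) :
    Set.range (cutProj A) ⊆
      closure (Submodule.span ℝ ((fun i => lp.single 1 i (1 : ℝ)) '' A) :
        Set (lp (fun _ : I => ℝ) 1)) := by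
  rintro _ ⟨x, rfl⟩
  refine mem_closure_of_tendsto (lp.summable_smul_of_norm_le_one (norm_cutVector_le A) x).hasSum
    (.of_forall fun s => Submodule.sum_mem _ fun i _ => Submodule.smul_mem _ _ ?_)
  obtain ⟨-, h0⟩ | ⟨b, hb, hb'⟩ := cutVector_cases A i
  · rw [h0]; exact zero_mem _
  · rw [hb']; exact Submodule.subset_span ⟨b, hb.1.1, rfl⟩

theorem isClosed_range_cutProj (A : Set I) : IsClosed (Set.range (cutProj A)) := by
  have : Set.range (cutProj A) = {x | cutProj A x = x} := by
    ext x
    refine ⟨?_, fun h => ⟨x, h⟩⟩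
    rintro ⟨y, rfl⟩
    exact DFunLike.congr_fun (cutProj_comp_of_subset (subset_refl A)) y
  rw [this]
  exact isClosed_eq (cutProj A).continuous continuous_id

theorem range_cutProj_mono {A B : Set I} (h : A ⊆ B) :
    Set.range (cutProj A) ⊆ Set.range (cutProj B) := by
  rintro _ ⟨x, rfl⟩
  exact ⟨cutProj A x, DFunLike.congr_fun (cutProj_comp_of_superset h) x⟩

theorem range_cutProj_iUnion {s : ℕ → Set I} (hs : Monotone s) :
    Set.range (cutProj (⋃ n, s n)) = closure (⋃ n, Set.range (cutProj (s n))) := by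
  refine subset_antisymm ((range_cutProj_subset _).trans (closure_mono ?_))
    (closure_minimal (Set.iUnion_subset fun n => range_cutProj_mono (Set.subset_iUnion s n))
      (isClosed_range_cutProj _))
  have hdir : Directed (· ≤ ·) fun n => LinearMap.range (cutProj (s n)).toLinearMap :=
    Monotone.directed_le fun m n hmn => range_cutProj_mono (hs hmn)
  have hcoe : (⋃ n, Set.range (cutProj (s n))) =
      ((⨆ n, LinearMap.range (cutProj (s n)).toLinearMap : Submodule ℝ _) : Set _) := by
    rw [Submodule.coe_iSup_of_directed _ hdir]; rfl
  rw [hcoe, SetLike.coe_subset_coe, Submodule.span_le, ← hcoe]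
  rintro _ ⟨i, hi, rfl⟩
  obtain ⟨n, hn⟩ := Set.mem_iUnion.1 hi
  exact Set.mem_iUnion.2 ⟨n, lp.single 1 i 1, by rw [cutProj_single, cutVector_of_mem hn]⟩

/-- The projectional skeleton of `ℓ₁(I)` formed by the projections `cutProj A`, `A` countable. -/
noncomputable def cutSkeleton (I : Type*) [LinearOrder I] [WellFoundedLT I] :
    ProjectionalSkeleton (lp (fun _ : I => ℝ) 1) {A : Set I // A.Countable} where
  proj A := cutProj A.1
  proj_idem A := cutProj_comp_of_subset (subset_refl A.1)
  directed A B := ⟨⟨A.1 ∪ B.1, A.2.union B.2⟩, Set.subset_union_left, Set.subset_union_right⟩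
  cover := Set.eq_univ_of_forall fun x => Set.mem_iUnion.2
    ⟨⟨_, lp.countable_support_one x⟩, x, cutProj_eq_self (subset_refl _)⟩
  separable A := ((A.2.image _).isSeparable.span (R := ℝ)).closure.mono (range_cutProj_subset A.1)
  compat A B h := ⟨(cutProj_comp_of_subset h).symm, (cutProj_comp_of_superset h).symm⟩
  sigma_complete s hs := by
    refine ⟨⟨⋃ n, (s n).1, Set.countable_iUnion fun n => (s n).2⟩, ⟨?_, fun B hB => ?_⟩,
      range_cutProj_iUnion (s := fun n => (s n).1) fun m n hmn => hs.monotone hmn⟩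
    · rintro _ ⟨n, rfl⟩
      exact Set.subset_iUnion (fun n => (s n).1) n
    · exact Set.iUnion_subset fun n => hB ⟨n, rfl⟩
  bounded := ⟨1, fun A => norm_cutProj_le A.1⟩

theorem cutSkeleton_isRNorming :
    IsRNorming 1 ((cutSkeleton I).inducedSpace : Set (StrongDual ℝ (lp (fun _ : I => ℝ) 1))) := by
  intro x
  rw [one_mul]
  rcases eq_or_ne x 0 with rfl | hx
  · rw [norm_zero]
    refine Real.sSup_nonneg ?_
    rintro _ ⟨φ, -, rfl⟩
    positivity
  obtain ⟨g, hg, hgx⟩ := exists_dual_vector'' ℝ x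
  set A := Function.support x
  have hφx : (g.comp (cutProj A)) x = ‖x‖ := by
    rw [ContinuousLinearMap.comp_apply, cutProj_eq_self (subset_refl _), hgx]; rfl
  have hφ0 : g.comp (cutProj A) ≠ 0 := fun h => by
    rw [h] at hφx
    exact hx (norm_eq_zero.1 hφx.symm)
  have hφ1 : ‖g.comp (cutProj A)‖ ≤ 1 :=
    (g.opNorm_comp_le _).trans (mul_le_one₀ hg (norm_nonneg _) (norm_cutProj_le A))
  have hbdd : BddAbove ((fun φ : StrongDual ℝ (lp (fun _ : I => ℝ) 1) => |φ x| / ‖φ‖) ''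
      (((cutSkeleton I).inducedSpace : Set _) \ {0})) := by
    refine ⟨‖x‖, ?_⟩
    rintro _ ⟨φ, hφ, rfl⟩
    refine div_le_of_le_mul₀ (norm_nonneg _) (norm_nonneg _) ?_
    rw [mul_comm]
    exact φ.le_opNorm x
  refine le_trans ?_ (le_csSup hbdd ⟨g.comp (cutProj A),
    ⟨Set.mem_iUnion.2 ⟨⟨A, lp.countable_support_one x⟩, g, rfl⟩, hφ0⟩, rfl⟩)
  simp only [hφx, abs_norm]
  rw [le_div_iff₀ (norm_pos_iff.2 hφ0)]
  exact mul_le_of_le_one_right (norm_nonneg _) hφ1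

end Cut

section IndicatorFunctional

open Classical in
/-- The functional on `ℓ₁(I)` summing the coordinates in `S`. -/
noncomputable def sumOver {I : Type*} (S : Set I) : StrongDual ℝ (lp (fun _ : I => ℝ) 1) :=
  lp.liftOne (fun i => if i ∈ S then (1 : ℝ) else 0) fun i => by split_ifs <;> simp

open Classical in
theorem sumOver_apply {I : Type*} (S : Set I) (x : lp (fun _ : I => ℝ) 1) :
    sumOver S x = ∑' i, if i ∈ S then x i else 0 := by
  simp [sumOver, lp.liftOne_apply]

theorem sumOver_congr {I : Type*} {S T : Set I} {x : lp (fun _ : I => ℝ) 1}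
    (h : ∀ i, x i ≠ 0 → (i ∈ S ↔ i ∈ T)) : sumOver S x = sumOver T x := by
  classical
  rw [sumOver_apply, sumOver_apply]
  refine tsum_congr fun i => ?_
  by_cases hi : x i = 0
  · simp [hi]
  · simp [h i hi]

theorem sumOver_singleton {I : Type*} (b : I) (x : lp (fun _ : I => ℝ) 1) :
    sumOver {b} x = x b := by
  classical
  rw [sumOver_apply, tsum_eq_single b fun i hi => by simp [hi]]
  simp

theorem sumOver_empty {I : Type*} (x : lp (fun _ : I => ℝ) 1) : sumOver ∅ x = 0 := by
  simp [sumOver_apply]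

theorem sumOver_Iic_mem_inducedSpace {I : Type*} [LinearOrder I] [WellFoundedLT I] (p : I) :
    sumOver (Set.Iic p) ∈ (cutSkeleton I).inducedSpace := by
  refine Set.mem_iUnion.2 ⟨⟨{p}, Set.countable_singleton p⟩, sumOver (Set.Iic p), ?_⟩
  refine lp.clm_ext_one fun i => ?_
  change sumOver _ (cutProj {p} _) = _
  rw [cutProj_single]
  by_cases hi : i ≤ p
  · rw [cutVector_of_isLeast (A := {p}) (a := p) ⟨⟨rfl, hi⟩, fun k hk => (Set.mem_singleton_iff.1 hk.1).ge⟩]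
    simp [sumOver, lp.liftOne_single, hi]
  · rw [cutVector_of_eq_empty (by simpa using hi)]
    simp [sumOver, lp.liftOne_single, hi]

end IndicatorFunctional

theorem not_exists_dense_countable_support (A : Set EllOneOmegaTwo)
    (hA : Dense (Submodule.span ℝ A : Set EllOneOmegaTwo))
    (hcount : ∀ y ∈ (cutSkeleton (ω_ 2 : Ordinal.{0}).ToType).inducedSpace,
      (functionalSupport y A).Countable) : False := by
  have hleast : ∀ b, {x ∈ A | IsLeast (Function.support x) b}.Countable := fun b => by
    refine (hcount _ (sumOver_Iic_mem_inducedSpace b)).mono fun x hx => ?_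
    refine ⟨hx.1, ?_⟩
    rw [sumOver_congr (T := {b}), sumOver_singleton]
    · exact hx.2.1
    · exact fun i hi => ⟨fun h => le_antisymm h (hx.2.2 hi), fun h => h.le⟩
  obtain ⟨d, hd, happrox⟩ := exists_unsplit_limit mk_Iic_omega_two_le
    exists_forall_lt_of_mk_le_aleph_one (fun x (_ : x ∈ A) => lp.countable_support_one x) hleast
  set S := {x ∈ functionalSupport (sumOver (Set.Iic d)) A | ∃ i, x i ≠ 0 ∧ i < d}
  have hSc : S.Countable := (hcount _ (sumOver_Iic_mem_inducedSpace d)).mono fun x hx => hx.1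
  have : Countable S := hSc.to_subtype
  choose m hm using fun x : S => x.2.2
  obtain ⟨c, hc, hcd, hmc⟩ := happrox (Set.range m) (by rintro _ ⟨x, rfl⟩; exact (hm x).2)
    (Set.countable_range m)
  have hvanish : ∀ x ∈ A, sumOver (Set.Ico c d) x = 0 := by
    intro x hx
    by_cases h1 : ∃ i, x i ≠ 0 ∧ i < c
    · obtain ⟨i, hi, hic⟩ := h1
      rw [sumOver_congr (T := ∅), sumOver_empty]
      exact fun j hj => ⟨fun h => (h.1.not_gt (hc x hx i hi hic j hj)).elim, False.elim⟩
    by_cases h2 : ∃ i, x i ≠ 0 ∧ i < d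
    · obtain ⟨i, hi, hid⟩ := h2
      rw [sumOver_congr (T := Set.Iic d)]
      · by_contra h0
        have hxS : x ∈ S := ⟨⟨hx, h0⟩, i, hi, hid⟩
        exact h1 ⟨m ⟨x, hxS⟩, (hm ⟨x, hxS⟩).1, hmc _ ⟨_, rfl⟩⟩
      · exact fun j hj => ⟨fun h => h.2.le, fun _ =>
          ⟨not_lt.1 fun h => h1 ⟨j, hj, h⟩, hd x hx i hi hid j hj⟩⟩
    · rw [sumOver_congr (T := ∅), sumOver_empty]
      exact fun j hj => ⟨fun h => h2 ⟨j, hj, h.2⟩, False.elim⟩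
  have hzero : sumOver (Set.Ico c d) = 0 := by
    refine ContinuousLinearMap.ext_on hA fun x hx => ?_
    simpa using hvanish x hx
  have h1 : sumOver (Set.Ico c d) (lp.single 1 c 1) = 1 := by
    simp [sumOver, lp.liftOne_single, hcd]
  rw [hzero] at h1
  exact zero_ne_one h1

theorem mainTheorem12 :
    ∃ (Γ : Type) (_ : PartialOrder Γ) (𝔰 : ProjectionalSkeleton EllOneOmegaTwo Γ),
      𝔰.IsRSkeleton 1 ∧
      IsRNorming 1 (𝔰.inducedSpace : Set (StrongDual ℝ EllOneOmegaTwo)) ∧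
      ¬ IsSigmaSpace 𝔰.inducedSpace ∧
      ¬ IsPlichkoPair EllOneOmegaTwo 𝔰.inducedSpace := by
  refine ⟨_, _, cutSkeleton (ω_ 2 : Ordinal.{0}).ToType, fun A => norm_cutProj_le A.1,
    cutSkeleton_isRNorming, ?_, ?_⟩
  · rintro ⟨-, A, hA, hD⟩
    exact not_exists_dense_countable_support A hA fun y hy => hD.subset hy
  · rintro ⟨-, A, hA, hD⟩
    exact not_exists_dense_countable_support A hA hD
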